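/- Let $M$ be a smooth manifold of dimension $n+1$. A Lorentz--Finsler Lagrangian on $M$ is a smooth function $\mathscr L\colon TM\setminus 0\to\mathbb R$, positively homogeneous of degree two in the velocities, whose velocity Hessian (the Finsler metric) $g_{\mu\nu}(x,v)=\partial^2\mathscr L/\partial v^\mu\partial v^\nu$, also written $g_v$, has signature $(-,+,\dots,+)$ at every $v\neq 0$. In local coordinates put $$2G^\alpha=g^{\alpha\delta}\Big(\frac{\partial^2\mathscr L}{\partial x^\gamma\partial v^\delta}v^\gamma-\frac{\partial\mathscr L}{\partial x^\delta}\Big),\qquad N^\alpha_\beta=\frac{\partial G^\alpha}{\partial v^\beta},\qquad \frac{\delta}{\delta x^\mu}=\frac{\partial}{\partial x^\mu}-N^\nu_\mu\frac{\partial}{\partial v^\nu},$$ $$R^\mu_{\alpha\beta}=\frac{\delta N^\mu_\beta}{\delta x^\alpha}-\frac{\delta N^\mu_\alpha}{\delta x^\beta},\qquad R_v\colon T_pM\to T_pM,\quad (R_v)^\alpha{}_\beta=R^\alpha_{\beta\mu}(x,v)\,v^\mu .$$ For $v\in T_pM\setminus 0$ lightlike, i.e. $g_v(v,v)=0$, let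 $V_v=\ker g_v(v,\cdot)/\mathbb R v$, a vector space of dimension $n-1$; write $\bar X\in V_v$ for the class of $X\in\ker g_v(v,\cdot)$, and let $\bar R\colon V_v\to V_v$, $\bar R(\bar X)=\overline{R_v(X)}$, and $\bar C=\bar R-\frac1{n-1}(\operatorname{tr}\bar R)\,\mathrm{Id}$ be its trace-free part. **Theorem.** Let $\mathscr L$ and $\tilde{\mathscr L}$ be Lorentz--Finsler Lagrangians on $M$ with conformal Finsler metrics, $\tilde g_v=\Omega^2 g_v$ for all $v\in TM\setminus 0$, where $\Omega$ is a positive function (it is allowed a priori to depend on $v$ as well as on the base point). Let $v\in T_pM\setminus0$ be lightlike for $g$. Then $R_v$ and $\tilde R_v$ annihilate $v$ and take values in $\ker g_v(v,\cdot)$ and $\ker\tilde g_v(v,\cdot)$ respectively, so that $\bar R$ and $\tilde{\bar R}$ are well defined; $\ker g_v(v,\cdot)=\ker\tilde g_v(v,\cdot)$, so that the two quotients $V_v$ coincide; and the trace-free parts agree: $\tilde{\bar C}=\bar C$. -/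

import Mathlib

open scoped Manifold ContDiff

noncomputable section

namespace FinslerSpacetime

section Coordinates

/-! Coordinate expressions, for a Lagrangian `l x v` on (an open part of) `E × E`; `x` is the
position and `v` the velocity. -/

variable {E : Type*} [NormedAddCommGroup E] [NormedSpace ℝ E]

/-- The Hessian of `l` in the velocities, `g_{μν}(x,v) = ∂²l/∂v^μ∂v^ν`. -/
def coordMetric (l : E → E → ℝ) (x v : E) : E →L[ℝ] E →L[ℝ] ℝ :=
  fderiv ℝ (fun w => fderiv ℝ (l x) w) v

/-- The covector `(∂²l/∂x^γ∂v^δ) v^γ - ∂l/∂x^δ`. -/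
def coordForce (l : E → E → ℝ) (x v : E) : E →L[ℝ] ℝ :=
  fderiv ℝ (fun y => fderiv ℝ (l y) v) x v - fderiv ℝ (fun y => l y v) x

/-- The spray coefficients `G^α`:
`2 G^α = g^{αδ} ((∂²l/∂x^γ∂v^δ) v^γ - ∂l/∂x^δ)`. -/
def coordSpray (l : E → E → ℝ) (x v : E) : E :=
  (1 / 2 : ℝ) • (coordMetric l x v).inverse (coordForce l x v)

/-- The non-linear connection `N^α_β = ∂G^α/∂v^β`, as the map `X ↦ N^α_β X^β`. -/
def coordConn (l : E → E → ℝ) (x v : E) : E →L[ℝ] E :=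
  fderiv ℝ (coordSpray l x) v

/-- The horizontal derivative `X^α δN/δx^α`, where `δ/δx^α = ∂/∂x^α - N^ν_α ∂/∂v^ν`. -/
def coordHorDerivConn (l : E → E → ℝ) (x v X : E) : E →L[ℝ] E :=
  fderiv ℝ (fun y => coordConn l y v) x X - fderiv ℝ (coordConn l x) v (coordConn l x v X)

/-- The curvature of the non-linear connection contracted with two vectors, `R^μ_{αβ} X^α Y^β`, where
`R^μ_{αβ} = δN^μ_β/δx^α - δN^μ_α/δx^β`. -/
def coordNonlinearCurvature (l : E → E → ℝ) (x v X Y : E) : E :=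
  coordHorDerivConn l x v X Y - coordHorDerivConn l x v Y X

/-- The curvature endomorphism `X ↦ R^α_{βμ}(x,v) X^β v^μ`. -/
def coordCurvature (l : E → E → ℝ) (x v : E) : E →ₗ[ℝ] E where
  toFun X := coordNonlinearCurvature l x v X v
  map_add' X Y := by
    simp only [coordNonlinearCurvature, coordHorDerivConn, map_add,
      sub_apply, add_apply]
    abel
  map_smul' c X := by
    simp only [coordNonlinearCurvature, coordHorDerivConn, map_smul,
      sub_apply, smul_apply, RingHom.id_apply, smul_sub]

end Coordinates

variable {E : Type*} [NormedAddCommGroup E] [NormedSpace ℝ E]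
  {M : Type*} [TopologicalSpace M] [ChartedSpace E M]

/-- The restriction of `L` to the fibre `T_p M`; in Mathlib `T_p M` is a copy of `E`. -/
def onFiber (L : TangentBundle 𝓘(ℝ, E) M → ℝ) (p : M) : E → ℝ :=
  fun u => L ⟨p, u⟩

/-- The Hessian at `v` of the restriction of `L` to the vector space `T_p M`. -/
def fiberHessian (L : TangentBundle 𝓘(ℝ, E) M → ℝ) (p : M) (v : E) : E →L[ℝ] E →L[ℝ] ℝ :=
  fderiv ℝ (fun w => fderiv ℝ (onFiber L p) w) v

/-- The Finsler metric `g_v` at `v ∈ T_p M`, as a bilinear form on `T_p M`. -/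
def metric (L : TangentBundle 𝓘(ℝ, E) M → ℝ) (p : M) (v : TangentSpace 𝓘(ℝ, E) p) :
    TangentSpace 𝓘(ℝ, E) p →L[ℝ] TangentSpace 𝓘(ℝ, E) p →L[ℝ] ℝ :=
  fiberHessian (E := E) L p v

/-- A bilinear form of signature `(-,+,…,+)` on a space of dimension `n + 1`. -/
def IsLorentzian (n : ℕ) {V : Type*} [AddCommGroup V] [Module ℝ V] (B : V → V → ℝ) : Prop :=
  ∃ b : Module.Basis (Fin (n + 1)) ℝ V, ∀ i j,
    B (b i) (b j) = if i = j then (if i = 0 then -1 else 1) else 0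

/-- `L` is a (smooth) Lorentz-Finsler Lagrangian on the `n + 1`-dimensional manifold `M`: its
restriction to the slit tangent bundle is smooth, positively homogeneous of degree two, with Hessian
`g_v` of Lorentzian signature. The values of `L` on the zero section are irrelevant. -/
structure IsLorentzFinsler [IsManifold 𝓘(ℝ, E) ∞ M] (n : ℕ)
    (L : TangentBundle 𝓘(ℝ, E) M → ℝ) : Prop where
  smooth : ContMDiffOn 𝓘(ℝ, E).tangent 𝓘(ℝ, ℝ) ∞ L {w | w.2 ≠ 0}
  homogeneous : ∀ (p : M) (v : TangentSpace 𝓘(ℝ, E) p), v ≠ 0 → ∀ s : ℝ, 0 < s →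
    L ⟨p, s • v⟩ = s ^ 2 * L ⟨p, v⟩
  lorentzian : ∀ (p : M) (v : TangentSpace 𝓘(ℝ, E) p), v ≠ 0 →
    IsLorentzian n (fun X Y => metric L p v X Y)

/-- The coordinate expression of `L` in a chart `φ`. -/
def inChart (L : TangentBundle 𝓘(ℝ, E) M → ℝ) (φ : OpenPartialHomeomorph M E) (x v : E) : ℝ :=
  L ⟨φ.symm x, mfderiv 𝓘(ℝ, E) 𝓘(ℝ, E) φ.symm x v⟩

/-- The curvature endomorphism `R_v : T_p M → T_p M`, through its coordinate expression
`R^α_β(x,v)` in the chart `φ` around `p`, where `D` is the differential of `φ` at `p`. -/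
def curvature (L : TangentBundle 𝓘(ℝ, E) M → ℝ) (φ : OpenPartialHomeomorph M E) (p : M)
    (v : TangentSpace 𝓘(ℝ, E) p) : Module.End ℝ (TangentSpace 𝓘(ℝ, E) p) :=
  let D : TangentSpace 𝓘(ℝ, E) p →L[ℝ] E := mfderiv 𝓘(ℝ, E) 𝓘(ℝ, E) φ p
  D.inverse.toLinearMap ∘ₗ coordCurvature (inChart L φ) (φ p) (D v) ∘ₗ D.toLinearMap

/-- The hyperplane `ker g_v(v, ·)` of `T_p M`. -/
def nullHyperplane (L : TangentBundle 𝓘(ℝ, E) M → ℝ) (p : M) (v : TangentSpace 𝓘(ℝ, E) p) :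
    Submodule ℝ (TangentSpace 𝓘(ℝ, E) p) :=
  LinearMap.ker (metric L p v v).toLinearMap

/-- The line spanned by `v`, inside `ker g_v(v, ·)` (for lightlike `v`). -/
def nullLine (L : TangentBundle 𝓘(ℝ, E) M → ℝ) (p : M) (v : TangentSpace 𝓘(ℝ, E) p) :
    Submodule ℝ (nullHyperplane L p v) :=
  (Submodule.span ℝ {v}).comap (nullHyperplane L p v).subtype

/-- The fibre `ker g_v(v, ·) / ℝ v` of the quotient bundle. -/
abbrev NullQuotient (L : TangentBundle 𝓘(ℝ, E) M → ℝ) (p : M) (v : TangentSpace 𝓘(ℝ, E) p) :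
    Type _ :=
  nullHyperplane L p v ⧸ nullLine L p v

/-- `R` passes to the quotient `ker g_v(v, ·) / ℝ v`: it annihilates `v` and takes values in
`ker g_v(v, ·)`. -/
def Descends (L : TangentBundle 𝓘(ℝ, E) M → ℝ) (p : M) (v : TangentSpace 𝓘(ℝ, E) p)
    (R : Module.End ℝ (TangentSpace 𝓘(ℝ, E) p)) : Prop :=
  R v = 0 ∧ ∀ X, R X ∈ nullHyperplane L p v

/-- The endomorphism `X̄ ↦ (R X)‾` of the quotient. -/
def descend (L : TangentBundle 𝓘(ℝ, E) M → ℝ) (p : M) (v : TangentSpace 𝓘(ℝ, E) p)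
    (R : Module.End ℝ (TangentSpace 𝓘(ℝ, E) p)) (h : Descends L p v R) :
    Module.End ℝ (NullQuotient L p v) :=
  Submodule.mapQ _ _ (R.restrict (p := nullHyperplane L p v) (q := nullHyperplane L p v)
    fun X _ => h.2 X) (by
      rintro ⟨X, hX⟩ hXv
      obtain ⟨c, rfl⟩ := Submodule.mem_span_singleton.1 (show X ∈ Submodule.span ℝ {v} from hXv)
      show R (c • v) ∈ Submodule.span ℝ {v}
      rw [map_smul, h.1, smul_zero]
      exact Submodule.zero_mem _)

open Classical in
/-- `R̄(X̄) := (R_v(X))‾`; the value `0` is used only if `R_v` does not pass to the quotient. -/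
def curvatureBar (L : TangentBundle 𝓘(ℝ, E) M → ℝ) (φ : OpenPartialHomeomorph M E) (p : M)
    (v : TangentSpace 𝓘(ℝ, E) p) : Module.End ℝ (NullQuotient L p v) :=
  if h : Descends L p v (curvature L φ p v) then descend L p v (curvature L φ p v) h else 0

/-- `C̄ := R̄ - (1/(n-1)) (tr R̄) Id`, the trace-free part of `R̄`. -/
def weylBar (n : ℕ) (L : TangentBundle 𝓘(ℝ, E) M → ℝ) (φ : OpenPartialHomeomorph M E) (p : M)
    (v : TangentSpace 𝓘(ℝ, E) p) : Module.End ℝ (NullQuotient L p v) :=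
  curvatureBar L φ p v
    - ((1 / ((n : ℝ) - 1)) * LinearMap.trace ℝ _ (curvatureBar L φ p v)) • LinearMap.id

/-- If `ker g_v(v, ·)` and `ker g̃_v(v, ·)` are the same hyperplane, then the two quotients by `ℝ v`
are the same: the identification `X̄ ↦ X̄`. -/
def nullQuotientEquiv (L L' : TangentBundle 𝓘(ℝ, E) M → ℝ) (p : M)
    (v : TangentSpace 𝓘(ℝ, E) p) (h : nullHyperplane L p v = nullHyperplane L' p v) :
    NullQuotient L p v ≃ₗ[ℝ] NullQuotient L' p v :=
  Submodule.Quotient.equiv _ _ (LinearEquiv.ofEq _ _ h) (by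
    ext ⟨X, hX⟩
    constructor
    · rintro ⟨Y, hY, hYX⟩
      have : (Y : TangentSpace 𝓘(ℝ, E) p) = X := congrArg Subtype.val hYX
      show X ∈ Submodule.span ℝ {v}
      rw [← this]
      exact hY
    · intro hXv
      exact ⟨⟨X, h ▸ hX⟩, hXv, rfl⟩)

end FinslerSpacetime

end

open scoped Manifold ContDiff

noncomputable section

namespace FinslerSpacetime

/-! ### Differentiating identities that hold on an open set -/

section Calculus

variable {V F : Type*} [NormedAddCommGroup V] [NormedSpace ℝ V]
  [NormedAddCommGroup F] [NormedSpace ℝ F] {U : Set V} {f g : V → F} {z : V}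

/-! In a chart the problem lives on an open set of pairs `(x, v)` with `v ≠ 0`. Let `l` be the
Lagrangian there, `G` its spray coefficients, `N` their vertical derivative, and `l'`, `G'` the
conformal data with factor `c = Ω²`.

Values of the curvature. Euler's relation makes the vertical differential of `l` equal to `g_v(v,
·)`. The Lagrangian is constant in horizontal directions (`IsSpray.fderiv_horLift`), and the
curvature is the vertical part of a commutator of horizontal fields, so `dl` kills it
(`IsSpray.fderiv_sprayCurvature`). That `R_v v = 0` is antisymmetry.

The factor. Third vertical derivatives of `l'` are symmetric, which forces `dc(X) g(Z, ·) = dc(Z)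
g(X, ·)` for vertical `X`, `Z`. Since `g` is nondegenerate and the dimension is at least two, `c`
does not vary with the velocity (`fderiv_factor_vertical`). Smoothness of `c` is not assumed; near a
given point `c` is a quotient of two Hessian coefficients (`coordCurvature_conformal`).

The curvature. Then `l' = c l` and `G' = G + a v - l w`, where `a` is half the derivative of `log c`
along `v` and `w` is half its `g_v`-gradient (`IsSpray.eq_add_of_conformal`). At a null vector,
applied to `X` in the null hyperplane, every term containing `w` or its derivatives carries as
coefficient `l`, `dl(0, X)`, `dl(0, v)` or a combination that vanishes by horizontal constancy and
the spray equation. What remains is `k X + b v` with `k` independent of `X`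
(`sprayCurvature_change`). In the quotient by `v` this is a scalar, which the trace-free part
forgets. -/

theorem hasFDerivAt_unique_of_eqOn (hU : IsOpen U) (hz : z ∈ U) (h : ∀ y ∈ U, f y = g y)
    {f' g' : V →L[ℝ] F} (hf : HasFDerivAt f f' z) (hg : HasFDerivAt g g' z) : f' = g' :=
  hf.unique (hg.congr_of_eventuallyEq (Filter.eventually_of_mem (hU.mem_nhds hz) h))

theorem contDiffOn_fderiv (hf : ContDiffOn ℝ ∞ f U) (hU : IsOpen U) :
    ContDiffOn ℝ ∞ (fderiv ℝ f) U :=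
  hf.fderiv_of_isOpen hU (by exact le_rfl)

theorem hasFDerivAt_of_contDiffOn (hf : ContDiffOn ℝ ∞ f U) (hU : IsOpen U) (hz : z ∈ U) :
    HasFDerivAt f (fderiv ℝ f z) z :=
  ((hf.contDiffAt (hU.mem_nhds hz)).differentiableAt (by simp)).hasFDerivAt

theorem hasFDerivAt_fderiv_of_contDiffOn (hf : ContDiffOn ℝ ∞ f U) (hU : IsOpen U) (hz : z ∈ U) :
    HasFDerivAt (fderiv ℝ f) (fderiv ℝ (fderiv ℝ f) z) z :=
  hasFDerivAt_of_contDiffOn (contDiffOn_fderiv hf hU) hU hz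

theorem fderiv_fderiv_symm (hf : ContDiffOn ℝ ∞ f U) (hU : IsOpen U) (hz : z ∈ U) (W W' : V) :
    fderiv ℝ (fderiv ℝ f) z W W' = fderiv ℝ (fderiv ℝ f) z W' W :=
  (hf.contDiffAt (hU.mem_nhds hz)).isSymmSndFDerivAt
    (by rw [minSmoothness_of_isRCLikeNormedField]; exact ENat.LEInfty.out) W W'

/-- The derivative of `y ↦ Df_y(u(y))`. -/
theorem hasFDerivAt_fderiv_apply (hf : ContDiffOn ℝ ∞ f U) (hU : IsOpen U) (hz : z ∈ U)
    {u : V → V} {u' : V →L[ℝ] V} (hu : HasFDerivAt u u' z) :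
    HasFDerivAt (fun y => fderiv ℝ f y (u y))
      ((fderiv ℝ f z).comp u' + (fderiv ℝ (fderiv ℝ f) z).flip (u z)) z :=
  (hasFDerivAt_fderiv_of_contDiffOn hf hU hz).clm_apply hu

/-- The derivative of `y ↦ D²f_y(u(y), w(y))`. -/
theorem hasFDerivAt_fderiv_fderiv_apply (hf : ContDiffOn ℝ ∞ f U) (hU : IsOpen U) (hz : z ∈ U)
    {u w : V → V} {u' w' : V →L[ℝ] V} (hu : HasFDerivAt u u' z) (hw : HasFDerivAt w w' z) :
    HasFDerivAt (fun y => fderiv ℝ (fderiv ℝ f) y (u y) (w y))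
      ((fderiv ℝ (fderiv ℝ f) z (u z)).comp w' +
        ((fderiv ℝ (fderiv ℝ f) z).comp u' +
          (fderiv ℝ (fderiv ℝ (fderiv ℝ f)) z).flip (u z)).flip (w z)) z :=
  (hasFDerivAt_fderiv_apply (contDiffOn_fderiv hf hU) hU hz hu).clm_apply hw

/-- Differentiate the symmetry of the second derivative. Symmetry in the first two slots is
`fderiv_fderiv_symm` applied to `fderiv ℝ f`. -/
theorem fderiv_fderiv_fderiv_symm (hf : ContDiffOn ℝ ∞ f U) (hU : IsOpen U) (hz : z ∈ U)
    (W₁ W₂ W₃ : V) : fderiv ℝ (fderiv ℝ (fderiv ℝ f)) z W₁ W₂ W₃ =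
      fderiv ℝ (fderiv ℝ (fderiv ℝ f)) z W₁ W₃ W₂ := by
  have h2 := hasFDerivAt_fderiv_fderiv_apply hf hU hz (hasFDerivAt_const W₂ z)
    (hasFDerivAt_const W₃ z)
  have h3 := hasFDerivAt_fderiv_fderiv_apply hf hU hz (hasFDerivAt_const W₃ z)
    (hasFDerivAt_const W₂ z)
  have := congrArg (fun A => A W₁) (hasFDerivAt_unique_of_eqOn hU hz
    (fun y hy => fderiv_fderiv_symm hf hU hy W₂ W₃) h2 h3)
  simpa using this

end Calculus

/-! ### Euler's relation, sprays and their curvature -/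

section Spray

variable {E : Type*} [NormedAddCommGroup E] [NormedSpace ℝ E]

theorem map_prodMk_neg {F : Type*} [NormedAddCommGroup F] [NormedSpace ℝ F]
    (A : E × E →L[ℝ] F) (X Y : E) : A (X, -Y) = A (X, 0) - A (0, Y) := by
  rw [← map_sub]; congr 1; ext <;> simp

theorem map_prodMk_smul {F : Type*} [NormedAddCommGroup F] [NormedSpace ℝ F]
    (A : E × E →L[ℝ] F) (c : ℝ) (Y : E) : A (0, c • Y) = c • A (0, Y) := by
  rw [← map_smul]; congr 1; ext <;> simp

theorem map_prodMk_add {F : Type*} [NormedAddCommGroup F] [NormedSpace ℝ F]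
    (A : E × E →L[ℝ] F) (X Y : E) : A (0, X + Y) = A (0, X) + A (0, Y) := by
  rw [← map_add]; congr 1; ext <;> simp

theorem map_prodMk_sub {F : Type*} [NormedAddCommGroup F] [NormedSpace ℝ F]
    (A : E × E →L[ℝ] F) (X Y : E) : A (0, X - Y) = A (0, X) - A (0, Y) := by
  rw [← map_sub]; congr 1; ext <;> simp

/-- The vector `(0, z.2)`, as a function of the point `z` of `E × E`. -/
theorem hasFDerivAt_vertical (z : E × E) : HasFDerivAt (fun y : E × E => ((0, y.2) : E × E))
    ((ContinuousLinearMap.inr ℝ E E).comp (ContinuousLinearMap.snd ℝ E E)) z :=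
  ((ContinuousLinearMap.inr ℝ E E).comp (ContinuousLinearMap.snd ℝ E E)).hasFDerivAt

/-- The vector `(z.2, 0)`, as a function of the point `z` of `E × E`. -/
theorem hasFDerivAt_base (z : E × E) : HasFDerivAt (fun y : E × E => ((y.2, 0) : E × E))
    ((ContinuousLinearMap.inl ℝ E E).comp (ContinuousLinearMap.snd ℝ E E)) z :=
  ((ContinuousLinearMap.inl ℝ E E).comp (ContinuousLinearMap.snd ℝ E E)).hasFDerivAt

/-- A smooth function on an open subset of `E × E` that satisfies Euler's relation for
homogeneity of degree two in the second variable. -/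
structure IsEulerOn {F : Type*} [NormedAddCommGroup F] [NormedSpace ℝ F]
    (U : Set (E × E)) (f : E × E → F) : Prop where
  smooth : ContDiffOn ℝ ∞ f U
  euler : ∀ z ∈ U, fderiv ℝ f z (0, z.2) = (2 : ℝ) • f z

/-- Derivative of Euler's relation along `W`. For vertical `W` it says that vertical derivatives are
homogeneous of degree one. -/
theorem IsEulerOn.snd {F : Type*} [NormedAddCommGroup F] [NormedSpace ℝ F]
    {U : Set (E × E)} {f : E × E → F} (hf : IsEulerOn U f) (hU : IsOpen U) {z : E × E}
    (hz : z ∈ U) (W : E × E) : fderiv ℝ (fderiv ℝ f) z W (0, z.2) =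
      (2 : ℝ) • fderiv ℝ f z W - fderiv ℝ f z (0, W.2) := by
  have h1 := hasFDerivAt_fderiv_apply hf.smooth hU hz (hasFDerivAt_vertical z)
  have h2 := (hasFDerivAt_of_contDiffOn hf.smooth hU hz).const_smul (2 : ℝ)
  have := congrArg (fun A => A W) (hasFDerivAt_unique_of_eqOn hU hz hf.euler h1 h2)
  simp at this
  rw [← this]; abel

theorem IsEulerOn.third {U : Set (E × E)} {f : E × E → ℝ} (hf : IsEulerOn U f) (hU : IsOpen U)
    {z : E × E} (hz : z ∈ U) (W W' : E × E) :
    fderiv ℝ (fderiv ℝ (fderiv ℝ f)) z (0, z.2) W W' = 2 * fderiv ℝ (fderiv ℝ f) z W W' -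
      fderiv ℝ (fderiv ℝ f) z W (0, W'.2) - fderiv ℝ (fderiv ℝ f) z W' (0, W.2) := by
  have h1 := hasFDerivAt_fderiv_fderiv_apply hf.smooth hU hz (hasFDerivAt_const W' z)
    (hasFDerivAt_vertical z)
  have h2 := ((hasFDerivAt_fderiv_apply hf.smooth hU hz (hasFDerivAt_const W' z)).const_smul
    (2 : ℝ)).sub (hasFDerivAt_fderiv_apply hf.smooth hU hz (hasFDerivAt_const ((0, W'.2) : E × E) z))
  have := congrArg (fun A => A W) (hasFDerivAt_unique_of_eqOn hU hz
    (fun y hy => hf.snd hU hy W') h1 h2)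
  simp at this
  rw [fderiv_fderiv_symm (contDiffOn_fderiv hf.smooth hU) hU hz,
    fderiv_fderiv_fderiv_symm hf.smooth hU hz]
  linarith

/-- `2 g(G, ·)` is the covector `(∂²l/∂x^γ∂v^δ) v^γ - ∂l/∂x^δ`, with `g` the Hessian in the second
variable. -/
structure IsSpray (U : Set (E × E)) (l : E × E → ℝ) (G : E × E → E) : Prop where
  smooth : ContDiffOn ℝ ∞ G U
  spray : ∀ z ∈ U, ∀ Y, 2 * fderiv ℝ (fderiv ℝ l) z (0, G z) (0, Y) =
    fderiv ℝ (fderiv ℝ l) z (z.2, 0) (0, Y) - fderiv ℝ l z (Y, 0)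

/-- Nondegeneracy of the Hessian in the second variable. -/
def IsNondegOn (U : Set (E × E)) (l : E × E → ℝ) : Prop :=
  ∀ z ∈ U, ∀ X, (∀ Y, fderiv ℝ (fderiv ℝ l) z (0, X) (0, Y) = 0) → X = 0

variable {U : Set (E × E)} {l : E × E → ℝ} {G : E × E → E} {z : E × E}

/-- Differentiating the spray equation along `(0, v)` shows that `dG(0, v) - 2 G` is `g`-orthogonal
to every vector; nondegeneracy finishes. -/
theorem IsSpray.isEulerOn (hG : IsSpray U l G) (hU : IsOpen U) (hl : IsEulerOn U l)
    (hnd : IsNondegOn U l) : IsEulerOn U G where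
  smooth := hG.smooth
  euler z hz := by
    rw [← sub_eq_zero]
    refine hnd z hz _ fun Y => ?_
    have hGz := (ContinuousLinearMap.inr ℝ E E).hasFDerivAt.comp z
      (hasFDerivAt_of_contDiffOn hG.smooth hU hz)
    have h1 := (hasFDerivAt_fderiv_fderiv_apply hl.smooth hU hz hGz
      (hasFDerivAt_const ((0, Y) : E × E) z)).const_mul 2
    have h2 := (hasFDerivAt_fderiv_fderiv_apply hl.smooth hU hz (hasFDerivAt_base z)
      (hasFDerivAt_const ((0, Y) : E × E) z)).sub
      (hasFDerivAt_fderiv_apply hl.smooth hU hz (hasFDerivAt_const ((Y, 0) : E × E) z))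
    have := congrArg (fun A => A (0, z.2)) (hasFDerivAt_unique_of_eqOn hU hz
      (fun y hy => hG.spray y hy Y) h1 h2)
    have e := hl.snd hU hz (Y, 0)
    have s := hG.spray z hz Y
    have e' := hl.snd hU hz (z.2, 0)
    simp [hl.third hU hz] at this
    rw [fderiv_fderiv_symm hl.smooth hU hz (0, z.2), e] at this
    rw [map_prodMk_sub, map_prodMk_smul]
    simp [← Prod.zero_eq_mk, fderiv_fderiv_symm hl.smooth hU hz (0, Y) (0, G z)] at this ⊢
    linarith

/-- The horizontal lift `X^α δ/δx^α` of `X`. -/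
def horLift (G : E × E → E) (z : E × E) (X : E) : E × E := (X, -fderiv ℝ G z (0, X))

/-- The curvature endomorphism of the spray coefficients `G`. -/
def sprayCurvature (G : E × E → E) (z : E × E) (X : E) : E :=
  fderiv ℝ (fderiv ℝ G) z (horLift G z X) (0, z.2) -
    fderiv ℝ (fderiv ℝ G) z (horLift G z z.2) (0, X)

/-- `l` is constant along horizontal curves. -/
theorem IsSpray.fderiv_horLift (hG : IsSpray U l G) (hU : IsOpen U) (hl : IsEulerOn U l)
    (hz : z ∈ U) (X : E) : fderiv ℝ l z (horLift G z X) = 0 := by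
  -- The spray equation paired with `Y = v`: `l` is constant along the geodesic field `(v, -2G)`.
  -- The general case is the derivative of this identity along `(0, X)`, combined with the spray
  -- equation again.
  have key : ∀ y ∈ U, fderiv ℝ l y (y.2, -((2 : ℝ) • G y)) = 0 := by
    intro y hy
    have s := hG.spray y hy y.2
    have e := hl.snd hU hy (0, G y)
    have e' := hl.snd hU hy (y.2, 0)
    rw [e, e'] at s
    simp at s
    rw [map_prodMk_neg, map_prodMk_smul]
    simp [← Prod.zero_eq_mk] at s ⊢
    linarith
  have hGz := (hasFDerivAt_base z).sub (((ContinuousLinearMap.inr ℝ E E).hasFDerivAt.comp z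
      (hasFDerivAt_of_contDiffOn hG.smooth hU hz)).const_smul (2 : ℝ))
  have key' : ∀ y ∈ U, fderiv ℝ l y ((y.2, 0) - (2 : ℝ) • (ContinuousLinearMap.inr ℝ E E) (G y))
      = (fun _ => (0 : ℝ)) y := by
    intro y hy
    rw [← key y hy]
    congr 1
    ext <;> simp
  have := congrArg (fun A => A (0, X)) (hasFDerivAt_unique_of_eqOn hU hz key'
    (hasFDerivAt_fderiv_apply hl.smooth hU hz hGz) (hasFDerivAt_const (0 : ℝ) z))
  have s := hG.spray z hz X
  simp at this
  rw [map_prodMk_neg, map_prodMk_smul, fderiv_fderiv_symm hl.smooth hU hz (0, X) (0, G z),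
      fderiv_fderiv_symm hl.smooth hU hz (0, X) (z.2, 0)] at this
  rw [horLift, map_prodMk_neg]
  simp at this
  linarith

theorem IsSpray.fderiv_sprayCurvature (hG : IsSpray U l G) (hU : IsOpen U) (hl : IsEulerOn U l)
    (hz : z ∈ U) (X : E) : fderiv ℝ l z (0, sprayCurvature G z X) = 0 := by
  -- Derivative along `W` of `dl(horLift X) = 0`. With it the two terms of the curvature become the
  -- second derivative of `l` on the two horizontal lifts, in either order, and cancel by symmetry.
  have key : ∀ X W, fderiv ℝ l z (0, fderiv ℝ (fderiv ℝ G) z W (0, X)) =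
      fderiv ℝ (fderiv ℝ l) z W (horLift G z X) := by
    intro X W
    have hN := (ContinuousLinearMap.inr ℝ E E).hasFDerivAt.comp z
      (hasFDerivAt_fderiv_apply hG.smooth hU hz (hasFDerivAt_const ((0, X) : E × E) z))
    have key' : ∀ y ∈ U, fderiv ℝ l y ((X, 0) -
        (ContinuousLinearMap.inr ℝ E E) (fderiv ℝ G y (0, X))) = (fun _ => (0 : ℝ)) y := by
      intro y hy
      refine Eq.trans ?_ (hG.fderiv_horLift hU hl hy X)
      congr 1
      ext <;> simp [horLift]
    have := congrArg (fun A => A W) (hasFDerivAt_unique_of_eqOn hU hz key'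
      (hasFDerivAt_fderiv_apply hl.smooth hU hz ((hasFDerivAt_const _ z).sub hN))
      (hasFDerivAt_const (0 : ℝ) z))
    simp at this
    rw [horLift]
    linarith
  rw [sprayCurvature, map_prodMk_sub, key, key, fderiv_fderiv_symm hl.smooth hU hz, sub_self]

end Spray

/-! ### Conformal change of the metric, the spray and the curvature -/

section Conformal

variable {E : Type*} [NormedAddCommGroup E] [NormedSpace ℝ E]
  {U : Set (E × E)} {l l' c a : E × E → ℝ} {G G' w : E × E → E} {z : E × E}

/-- Conformal Hessians force the differential of the factor to be divisible. -/
theorem fderiv_factor_mul (hU : IsOpen U) (hl : ContDiffOn ℝ ∞ l U) (hl' : ContDiffOn ℝ ∞ l' U)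
    (hc : ContDiffOn ℝ ∞ c U)
    (h : ∀ z ∈ U, ∀ X Y, fderiv ℝ (fderiv ℝ l') z (0, X) (0, Y) =
      c z * fderiv ℝ (fderiv ℝ l) z (0, X) (0, Y)) (hz : z ∈ U) (X Z Y : E) :
    fderiv ℝ c z (0, X) * fderiv ℝ (fderiv ℝ l) z (0, Z) (0, Y) =
      fderiv ℝ c z (0, Z) * fderiv ℝ (fderiv ℝ l) z (0, X) (0, Y) := by
  have key : ∀ X Z : E, fderiv ℝ (fderiv ℝ (fderiv ℝ l')) z (0, X) (0, Z) (0, Y) =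
      c z * fderiv ℝ (fderiv ℝ (fderiv ℝ l)) z (0, X) (0, Z) (0, Y) +
        fderiv ℝ c z (0, X) * fderiv ℝ (fderiv ℝ l) z (0, Z) (0, Y) := by
    intro X Z
    have h1 := hasFDerivAt_fderiv_fderiv_apply hl' hU hz (hasFDerivAt_const ((0, Z) : E × E) z)
      (hasFDerivAt_const ((0, Y) : E × E) z)
    have h2 := hasFDerivAt_fderiv_fderiv_apply hl hU hz (hasFDerivAt_const ((0, Z) : E × E) z)
      (hasFDerivAt_const ((0, Y) : E × E) z)
    have := congrArg (fun A => A (0, X)) (hasFDerivAt_unique_of_eqOn hU hz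
      (fun y hy => h y hy Z Y) h1 ((hasFDerivAt_of_contDiffOn hc hU hz).mul h2))
    simp at this
    rw [this]; ring
  have e := key X Z
  rw [fderiv_fderiv_symm (contDiffOn_fderiv hl' hU) hU hz, key Z X,
    fderiv_fderiv_symm (contDiffOn_fderiv hl hU) hU hz] at e
  linarith

/-- A conformal factor between Hessians does not depend on the velocity. -/
theorem fderiv_factor_vertical [FiniteDimensional ℝ E] (hE : 1 < Module.finrank ℝ E)
    (hU : IsOpen U) (hl : ContDiffOn ℝ ∞ l U) (hl' : ContDiffOn ℝ ∞ l' U)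
    (hc : ContDiffOn ℝ ∞ c U) (hnd : IsNondegOn U l)
    (h : ∀ z ∈ U, ∀ X Y, fderiv ℝ (fderiv ℝ l') z (0, X) (0, Y) =
      c z * fderiv ℝ (fderiv ℝ l) z (0, X) (0, Y)) (hz : z ∈ U) (X : E) :
    fderiv ℝ c z (0, X) = 0 := by
  rcases eq_or_ne X 0 with rfl | hX
  · exact map_zero (fderiv ℝ c z)
  -- This is where dimension at least two enters: `dc(X) Z - dc(Z) X` lies in the kernel of `g`, so
  -- it vanishes, and independence gives `dc(X) = 0`.
  obtain ⟨Z, hZ⟩ := exists_linearIndependent_pair_of_one_lt_finrank hE hX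
  have key : fderiv ℝ c z (0, X) • Z - fderiv ℝ c z (0, Z) • X = 0 := hnd z hz _ fun Y => by
    rw [map_prodMk_sub, map_prodMk_smul, map_prodMk_smul, sub_apply, smul_apply, smul_apply,
      smul_eq_mul, smul_eq_mul, fderiv_factor_mul hU hl hl' hc h hz, sub_self]
  exact (LinearIndependent.pair_iff.1 hZ (-fderiv ℝ c z (0, Z)) (fderiv ℝ c z (0, X))
    (by rw [neg_smul, neg_add_eq_sub, key])).2

theorem IsEulerOn.hessian_self (hl : IsEulerOn U l) (hU : IsOpen U) (hz : z ∈ U) :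
    fderiv ℝ (fderiv ℝ l) z (0, z.2) (0, z.2) = 2 * l z := by
  have e := hl.snd hU hz (0, z.2)
  have e' := hl.euler z hz
  simp only [smul_eq_mul] at e e'
  rw [e]; linarith

/-- Both Lagrangians are recovered from their Hessians by `g_v(v, v) = 2 l`. -/
theorem eq_factor_mul (hU : IsOpen U) (hl : IsEulerOn U l) (hl' : IsEulerOn U l')
    (h : ∀ z ∈ U, ∀ X Y, fderiv ℝ (fderiv ℝ l') z (0, X) (0, Y) =
      c z * fderiv ℝ (fderiv ℝ l) z (0, X) (0, Y)) (hz : z ∈ U) : l' z = c z * l z := by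
  have := h z hz z.2 z.2
  rw [hl.hessian_self hU hz, hl'.hessian_self hU hz] at this
  linarith

/-- The change of the spray under a conformal change of the metric. -/
theorem IsSpray.eq_add_of_conformal (hU : IsOpen U) (hl : IsEulerOn U l) (hl' : IsEulerOn U l')
    (hc : ContDiffOn ℝ ∞ c U) (hc0 : ∀ z ∈ U, c z ≠ 0) (hnd : IsNondegOn U l)
    (h : ∀ z ∈ U, ∀ X Y, fderiv ℝ (fderiv ℝ l') z (0, X) (0, Y) =
      c z * fderiv ℝ (fderiv ℝ l) z (0, X) (0, Y))
    (hcv : ∀ z ∈ U, ∀ X, fderiv ℝ c z (0, X) = 0)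
    (hG : IsSpray U l G) (hG' : IsSpray U l' G')
    (ha : ∀ z ∈ U, a z = (c z)⁻¹ * fderiv ℝ c z (z.2, 0) / 2)
    (hw : ∀ z ∈ U, ∀ Y, fderiv ℝ (fderiv ℝ l) z (0, w z) (0, Y) =
      (c z)⁻¹ * fderiv ℝ c z (Y, 0) / 2) (hz : z ∈ U) :
    G' z = G z + (a z • z.2 - l z • w z) := by
  have hlc : ∀ y ∈ U, l' y = c y * l y := fun y hy => eq_factor_mul hU hl hl' h hy
  have d1 : ∀ y ∈ U, fderiv ℝ l' y = c y • fderiv ℝ l y + l y • fderiv ℝ c y := fun y hy =>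
    hasFDerivAt_unique_of_eqOn hU hy hlc (hasFDerivAt_of_contDiffOn hl'.smooth hU hy)
      ((hasFDerivAt_of_contDiffOn hc hU hy).mul (hasFDerivAt_of_contDiffOn hl.smooth hU hy))
  rw [← sub_eq_zero]
  refine hnd z hz _ fun Y => ?_
  have d2 := congrArg (fun A => A (z.2, 0) (0, Y)) (hasFDerivAt_unique_of_eqOn hU hz d1
    (hasFDerivAt_fderiv_of_contDiffOn hl'.smooth hU hz)
    (((hasFDerivAt_of_contDiffOn hc hU hz).smul
      (hasFDerivAt_fderiv_of_contDiffOn hl.smooth hU hz)).add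
      ((hasFDerivAt_of_contDiffOn hl.smooth hU hz).smul
      (hasFDerivAt_fderiv_of_contDiffOn hc hU hz))))
  have dc : fderiv ℝ (fderiv ℝ c) z (z.2, 0) (0, Y) = 0 := by
    have := congrArg (fun A => A (z.2, 0)) (hasFDerivAt_unique_of_eqOn hU hz
      (fun y hy => hcv y hy Y)
      (hasFDerivAt_fderiv_apply hc hU hz (hasFDerivAt_const ((0, Y) : E × E) z))
      (hasFDerivAt_const (0 : ℝ) z))
    simpa using this
  have e := hl.snd hU hz (0, Y)
  rw [fderiv_fderiv_symm hl.smooth hU hz] at e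
  have s := hG.spray z hz Y
  have s' := hG'.spray z hz Y
  rw [h z hz, d1 z hz] at s'
  simp [hcv z hz, dc] at d2 s'
  rw [d2] at s'
  have e2 : fderiv ℝ (fderiv ℝ l) z (0, z.2) (0, Y) = fderiv ℝ l z (0, Y) := by
    rw [e]; simp; ring
  have hc' := hc0 z hz
  rw [map_prodMk_sub, map_prodMk_add, map_prodMk_sub, map_prodMk_smul, map_prodMk_smul]
  simp only [add_apply, sub_apply, smul_apply, smul_eq_mul, hw z hz, ha z hz, e2]
  have e3 : fderiv ℝ (fderiv ℝ l) z (0, G' z) (0, Y) = (2 * c z)⁻¹ * (2 * (c z *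
    fderiv ℝ (fderiv ℝ l) z (0, G' z) (0, Y))) := by field_simp
  rw [e3, s', show fderiv ℝ (fderiv ℝ l) z (0, G z) (0, Y) = (2 : ℝ)⁻¹ * (2 *
    fderiv ℝ (fderiv ℝ l) z (0, G z) (0, Y)) by ring, s]
  field_simp
  ring

/-- Homogeneity of `G` gives `N v = 2 G` and removes the second derivative with the velocity in one
slot; the result is convenient for substituting `G'`. -/
theorem sprayCurvature_eq (hU : IsOpen U) (hG : IsEulerOn U G) (hz : z ∈ U) (X : E) :
    sprayCurvature G z X = (2 : ℝ) • fderiv ℝ G z (X, 0) -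
      fderiv ℝ G z (0, fderiv ℝ G z (0, X)) - fderiv ℝ (fderiv ℝ G) z (z.2, 0) (0, X) +
      fderiv ℝ (fderiv ℝ G) z (0, (2 : ℝ) • G z) (0, X) := by
  rw [sprayCurvature, hG.snd hU hz, horLift, horLift, hG.euler z hz]
  dsimp only
  rw [map_prodMk_neg, map_prodMk_neg, map_prodMk_neg, sub_apply, ← Prod.zero_eq_mk, map_zero]
  module

/-- The change of the curvature under a projective-like change of the spray, at null vectors and
modulo the direction of the velocity. -/
theorem sprayCurvature_change (hU : IsOpen U) (hl : IsEulerOn U l) (hG : IsSpray U l G)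
    (hGe : IsEulerOn U G) (hGe' : IsEulerOn U G')
    (ha : ContDiffOn ℝ ∞ a U) (hw : ContDiffOn ℝ ∞ w U)
    (hav : ∀ z ∈ U, fderiv ℝ a z (0, z.2) = a z)
    (hP : ∀ z ∈ U, G' z = G z + (a z • z.2 - l z • w z)) (hz : z ∈ U) (hlz : l z = 0) :
    ∃ k : ℝ, ∀ X, fderiv ℝ l z (0, X) = 0 → ∃ b : ℝ,
      sprayCurvature G' z X = sprayCurvature G z X + k • X + b • z.2 := by
  have hsnd : ∀ y : E × E, HasFDerivAt (fun y : E × E => y.2) (ContinuousLinearMap.snd ℝ E E) y :=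
    fun y => hasFDerivAt_snd
  have d1 : ∀ W : E × E, ∀ y ∈ U, fderiv ℝ G' y W = fderiv ℝ G y W + (a y • W.2 +
      fderiv ℝ a y W • y.2 - (l y • fderiv ℝ w y W + fderiv ℝ l y W • w y)) := by
    intro W y hy
    have := congrArg (fun A => A W) (hasFDerivAt_unique_of_eqOn hU hy hP
      (hasFDerivAt_of_contDiffOn hGe'.smooth hU hy)
      ((hasFDerivAt_of_contDiffOn hG.smooth hU hy).add
        (((hasFDerivAt_of_contDiffOn ha hU hy).smul (hsnd y)).sub
        ((hasFDerivAt_of_contDiffOn hl.smooth hU hy).smul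
          (hasFDerivAt_of_contDiffOn hw hU hy)))))
    simpa using this
  have d2 : ∀ W W' : E × E, fderiv ℝ (fderiv ℝ G') z W W' = fderiv ℝ (fderiv ℝ G) z W W' +
      (fderiv ℝ a z W • W'.2 + fderiv ℝ a z W' • W.2 + fderiv ℝ (fderiv ℝ a) z W W' • z.2
      - (fderiv ℝ l z W • fderiv ℝ w z W' + fderiv ℝ l z W' • fderiv ℝ w z W +
        fderiv ℝ (fderiv ℝ l) z W W' • w z)) := by
    intro W W'
    have hcW : HasFDerivAt (fun _ : E × E => W') (0 : E × E →L[ℝ] E × E) z :=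
      hasFDerivAt_const W' z
    have := congrArg (fun A => A W) (hasFDerivAt_unique_of_eqOn hU hz (d1 W')
      (hasFDerivAt_fderiv_apply hGe'.smooth hU hz hcW)
      ((hasFDerivAt_fderiv_apply hG.smooth hU hz hcW).add
        ((((hasFDerivAt_of_contDiffOn ha hU hz).smul (hasFDerivAt_const W'.2 z)).add
          ((hasFDerivAt_fderiv_apply ha hU hz hcW).smul (hsnd z))).sub
        (((hasFDerivAt_of_contDiffOn hl.smooth hU hz).smul
          (hasFDerivAt_fderiv_apply hw hU hz hcW)).add
          ((hasFDerivAt_fderiv_apply hl.smooth hU hz hcW).smul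
            (hasFDerivAt_of_contDiffOn hw hU hz))))))
    simp [hlz] at this
    rw [this]
    module
  -- The scalar `k` is `a²` minus the derivative of `a` along the horizontal lift `(v, -2G)`.
  refine ⟨a z ^ 2 - fderiv ℝ a z (z.2, 0) + 2 * fderiv ℝ a z (0, G z), fun X hX => ?_⟩
  have hl0 : fderiv ℝ l z (0, z.2) = 0 := by rw [hl.euler z hz, hlz, smul_zero]
  -- Together `e1`, `e2` and `e3` make the coefficients of `w` and of its derivative along `(0, X)`
  -- cancel.
  have e1 : fderiv ℝ l z (X, 0) = fderiv ℝ l z (0, fderiv ℝ G z (0, X)) := by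
    have := hG.fderiv_horLift hU hl hz X
    rw [horLift, map_prodMk_neg] at this
    linarith
  have e2 : fderiv ℝ l z (z.2, 0) = 2 * fderiv ℝ l z (0, G z) := by
    have := hG.fderiv_horLift hU hl hz z.2
    rw [horLift, map_prodMk_neg, hGe.euler z hz, map_prodMk_smul, smul_eq_mul] at this
    linarith
  have e3 : fderiv ℝ (fderiv ℝ l) z (z.2, 0) (0, X) =
      2 * fderiv ℝ (fderiv ℝ l) z (0, G z) (0, X) + fderiv ℝ l z (0, fderiv ℝ G z (0, X)) := by
    have := hG.spray z hz X
    linarith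
  have e4 : fderiv ℝ (fderiv ℝ l) z (0, z.2) (0, X) = 0 := by
    rw [fderiv_fderiv_symm hl.smooth hU hz, hl.snd hU hz, hX]; simp
  have e5 : fderiv ℝ (fderiv ℝ G) z (0, z.2) (0, X) = fderiv ℝ G z (0, X) := by
    rw [fderiv_fderiv_symm hG.smooth hU hz, hGe.snd hU hz]; module
  -- The witness `b` collects the coefficients of the velocity; its value is irrelevant in the
  -- quotient.
  refine ⟨2 * fderiv ℝ a z (X, 0) - fderiv ℝ a z (0, fderiv ℝ G z (0, X))
    - a z * fderiv ℝ a z (0, X) - fderiv ℝ (fderiv ℝ a) z (z.2, 0) (0, X)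
    + fderiv ℝ (fderiv ℝ a) z (0, (2 : ℝ) • G z + (2 * a z) • z.2) (0, X), ?_⟩
  have hG'z : (2 : ℝ) • G' z = (2 : ℝ) • G z + (2 * a z) • z.2 := by
    rw [hP z hz, hlz]; module
  rw [sprayCurvature_eq hU hGe' hz, sprayCurvature_eq hU hGe hz, hG'z]
  have q : fderiv ℝ G' z (0, X) = fderiv ℝ G z (0, X) + a z • X + fderiv ℝ a z (0, X) • z.2 := by
    rw [d1 _ z hz, hX, hlz]; module
  rw [q]
  simp only [d2, d1 _ z hz, map_prodMk_add, map_prodMk_smul, hlz, hX, add_apply, smul_apply, e5, e4, e3, e2,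
    e1, hl0, hav z hz, hGe.euler z hz, smul_eq_mul]
  module

end Conformal

/-! ### Partial derivatives as derivatives on the product -/

section Partial

variable {E F : Type*} [NormedAddCommGroup E] [NormedSpace ℝ E]
  [NormedAddCommGroup F] [NormedSpace ℝ F]
  {U : Set (E × E)} {f : E → E → F} {x v : E}

theorem fderiv_partial_snd (hf : DifferentiableAt ℝ (Function.uncurry f) (x, v)) :
    fderiv ℝ (f x) v = (fderiv ℝ (Function.uncurry f) (x, v)).comp
      (ContinuousLinearMap.inr ℝ E E) :=
  (hf.hasFDerivAt.comp v (hasFDerivAt_prodMk_right x v)).fderiv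

theorem fderiv_partial_fst (hf : DifferentiableAt ℝ (Function.uncurry f) (x, v)) :
    fderiv ℝ (fun y => f y v) x = (fderiv ℝ (Function.uncurry f) (x, v)).comp
      (ContinuousLinearMap.inl ℝ E E) :=
  (HasFDerivAt.comp (g := Function.uncurry f) (f := fun y => (y, v)) x hf.hasFDerivAt
    (hasFDerivAt_prodMk_left x v)).fderiv

theorem differentiableAt_of_contDiffOn {f : E × E → F} {z : E × E} (hf : ContDiffOn ℝ ∞ f U)
    (hU : IsOpen U) (hz : z ∈ U) : DifferentiableAt ℝ f z :=
  (hasFDerivAt_of_contDiffOn hf hU hz).differentiableAt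

/-- The derivative in the second variable, as a function on the product, agrees with the partial
derivative of the uncurried function. -/
theorem uncurry_fderiv_snd_eventuallyEq (hU : IsOpen U)
    (hf : ContDiffOn ℝ ∞ (Function.uncurry f) U) (hz : (x, v) ∈ U) :
    Function.uncurry (fun y w => fderiv ℝ (f y) w) =ᶠ[nhds (x, v)]
      fun z => (fderiv ℝ (Function.uncurry f) z).comp (ContinuousLinearMap.inr ℝ E E) :=
  Filter.eventually_of_mem (hU.mem_nhds hz) fun _ hy =>
    fderiv_partial_snd (differentiableAt_of_contDiffOn hf hU hy)

theorem hasFDerivAt_uncurry_fderiv_snd (hU : IsOpen U)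
    (hf : ContDiffOn ℝ ∞ (Function.uncurry f) U) (hz : (x, v) ∈ U) :
    HasFDerivAt (Function.uncurry (fun y w => fderiv ℝ (f y) w))
      (((ContinuousLinearMap.compL ℝ E (E × E) F).flip (ContinuousLinearMap.inr ℝ E E)).comp
        (fderiv ℝ (fderiv ℝ (Function.uncurry f)) (x, v))) (x, v) :=
  (((ContinuousLinearMap.compL ℝ E (E × E) F).flip
    (ContinuousLinearMap.inr ℝ E E)).hasFDerivAt.comp (x, v)
    (hasFDerivAt_fderiv_of_contDiffOn hf hU hz)).congr_of_eventuallyEq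
    (uncurry_fderiv_snd_eventuallyEq hU hf hz)

theorem fderiv_snd_snd (hU : IsOpen U) (hf : ContDiffOn ℝ ∞ (Function.uncurry f) U)
    (hz : (x, v) ∈ U) (X Y : E) : fderiv ℝ (fun w => fderiv ℝ (f x) w) v X Y =
      fderiv ℝ (fderiv ℝ (Function.uncurry f)) (x, v) (0, X) (0, Y) := by
  have h := hasFDerivAt_uncurry_fderiv_snd hU hf hz
  rw [fderiv_partial_snd (f := fun y w => fderiv ℝ (f y) w) h.differentiableAt, h.fderiv]
  simp

theorem fderiv_fst_snd (hU : IsOpen U) (hf : ContDiffOn ℝ ∞ (Function.uncurry f) U)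
    (hz : (x, v) ∈ U) (X Y : E) : fderiv ℝ (fun y => fderiv ℝ (f y) v) x X Y =
      fderiv ℝ (fderiv ℝ (Function.uncurry f)) (x, v) (X, 0) (0, Y) := by
  have h := hasFDerivAt_uncurry_fderiv_snd hU hf hz
  rw [fderiv_partial_fst (f := fun y w => fderiv ℝ (f y) w) h.differentiableAt, h.fderiv]
  simp

end Partial

/-! ### Inverting the vertical Hessian smoothly -/

section VerticalHessian

variable {E : Type*} [NormedAddCommGroup E] [NormedSpace ℝ E]
  {U : Set (E × E)} {l : E × E → ℝ} {z : E × E}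

/-- The Hessian of `l` in the second variable. -/
def verticalHessian (l : E × E → ℝ) (z : E × E) : E →L[ℝ] E →L[ℝ] ℝ :=
  ((ContinuousLinearMap.compL ℝ E (E × E) ℝ).flip (ContinuousLinearMap.inr ℝ E E)).comp
    ((fderiv ℝ (fderiv ℝ l) z).comp (ContinuousLinearMap.inr ℝ E E))

@[simp]
theorem verticalHessian_apply (X Y : E) :
    verticalHessian l z X Y = fderiv ℝ (fderiv ℝ l) z (0, X) (0, Y) := by
  simp [verticalHessian]

theorem contDiffOn_verticalHessian (hl : ContDiffOn ℝ ∞ l U) (hU : IsOpen U) :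
    ContDiffOn ℝ ∞ (verticalHessian l) U :=
  contDiffOn_const.clm_comp
    ((contDiffOn_fderiv (contDiffOn_fderiv hl hU) hU).clm_comp contDiffOn_const)

theorem IsNondegOn.mono {U' : Set (E × E)} {l : E × E → ℝ} (h : IsNondegOn U l) (hU : U' ⊆ U) :
    IsNondegOn U' l := fun z hz => h z (hU hz)

theorem IsEulerOn.mono {U' : Set (E × E)} {l : E × E → ℝ} (h : IsEulerOn U l) (hU : U' ⊆ U) :
    IsEulerOn U' l := ⟨h.smooth.mono hU, fun z hz => h.euler z (hU hz)⟩

variable [FiniteDimensional ℝ E]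

/-- Ensures that `ContinuousLinearMap.inverse` is the true inverse here, not its default value `0`,
and that it is smooth at the Hessian. -/
theorem IsNondegOn.exists_equiv (hnd : IsNondegOn U l) (hz : z ∈ U) :
    ∃ e : E ≃L[ℝ] (E →L[ℝ] ℝ), (e : E →L[ℝ] (E →L[ℝ] ℝ)) = verticalHessian l z := by
  have hinj : Function.Injective (verticalHessian l z).toLinearMap := by
    rw [← LinearMap.ker_eq_bot, LinearMap.ker_eq_bot']
    intro X hX
    refine hnd z hz X fun Y => ?_
    rw [← verticalHessian_apply]
    exact congrArg (fun A : E →L[ℝ] ℝ => A Y) hX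
  have hrank : Module.finrank ℝ E = Module.finrank ℝ (E →L[ℝ] ℝ) := by
    rw [← LinearEquiv.finrank_eq (LinearMap.toContinuousLinearMap (𝕜 := ℝ) (E := E) (F' := ℝ))]
    exact (Subspace.dual_finrank_eq (K := ℝ) (V := E)).symm
  exact ⟨(LinearEquiv.ofInjectiveOfFinrankEq _ hinj hrank).toContinuousLinearEquiv, rfl⟩

theorem IsNondegOn.verticalHessian_inverse (hnd : IsNondegOn U l) (hz : z ∈ U) (α : E →L[ℝ] ℝ) :
    verticalHessian l z ((verticalHessian l z).inverse α) = α := by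
  obtain ⟨e, he⟩ := hnd.exists_equiv hz
  rw [← he, ContinuousLinearMap.inverse_equiv]
  simp

theorem IsNondegOn.contDiffOn_inverse (hnd : IsNondegOn U l) (hU : IsOpen U)
    (hl : ContDiffOn ℝ ∞ l U) {α : E × E → E →L[ℝ] ℝ} (hα : ContDiffOn ℝ ∞ α U) :
    ContDiffOn ℝ ∞ (fun z => (verticalHessian l z).inverse (α z)) U := by
  have : CompleteSpace E := FiniteDimensional.complete ℝ E
  intro z hz
  obtain ⟨e, he⟩ := hnd.exists_equiv hz
  have h1 : ContDiffAt ℝ ∞ ContinuousLinearMap.inverse (verticalHessian l z) :=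
    he ▸ contDiffAt_map_inverse e
  exact (h1.comp_contDiffWithinAt z (contDiffOn_verticalHessian hl hU z hz)).clm_apply (hα z hz)

end VerticalHessian

/-! ### The coordinate definitions in terms of derivatives on the product -/

section CoordinateLink

variable {E : Type*} [NormedAddCommGroup E] [NormedSpace ℝ E]
  {U : Set (E × E)} {l : E → E → ℝ} {x v : E}

theorem coordMetric_apply (hU : IsOpen U) (hl : ContDiffOn ℝ ∞ (Function.uncurry l) U)
    (hz : (x, v) ∈ U) (X Y : E) : coordMetric l x v X Y =
      fderiv ℝ (fderiv ℝ (Function.uncurry l)) (x, v) (0, X) (0, Y) :=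
  fderiv_snd_snd hU hl hz X Y

theorem coordMetric_eq (hU : IsOpen U) (hl : ContDiffOn ℝ ∞ (Function.uncurry l) U)
    (hz : (x, v) ∈ U) : coordMetric l x v = verticalHessian (Function.uncurry l) (x, v) := by
  ext X Y
  rw [coordMetric_apply hU hl hz, verticalHessian_apply]

theorem coordForce_eq (hU : IsOpen U) (hl : ContDiffOn ℝ ∞ (Function.uncurry l) U)
    (hz : (x, v) ∈ U) : coordForce l x v =
      (fderiv ℝ (fderiv ℝ (Function.uncurry l)) (x, v) (v, 0)).comp
        (ContinuousLinearMap.inr ℝ E E) -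
      (fderiv ℝ (Function.uncurry l) (x, v)).comp (ContinuousLinearMap.inl ℝ E E) := by
  ext Y
  rw [coordForce, fderiv_partial_fst (differentiableAt_of_contDiffOn hl hU hz), sub_apply,
    fderiv_fst_snd hU hl hz]
  simp

theorem isSpray_coordSpray [FiniteDimensional ℝ E] (hU : IsOpen U)
    (hl : ContDiffOn ℝ ∞ (Function.uncurry l) U) (hnd : IsNondegOn U (Function.uncurry l)) :
    IsSpray U (Function.uncurry l) (Function.uncurry (coordSpray l)) where
  smooth := by
    have h2 := contDiffOn_fderiv (contDiffOn_fderiv hl hU) hU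
    have hα : ContDiffOn ℝ ∞ (fun z : E × E =>
        (fderiv ℝ (fderiv ℝ (Function.uncurry l)) z (z.2, 0)).comp
          (ContinuousLinearMap.inr ℝ E E) -
        (fderiv ℝ (Function.uncurry l) z).comp (ContinuousLinearMap.inl ℝ E E)) U :=
      ((h2.clm_apply (contDiffOn_snd.prodMk contDiffOn_const)).clm_comp contDiffOn_const).sub
        ((contDiffOn_fderiv hl hU).clm_comp contDiffOn_const)
    refine ((hnd.contDiffOn_inverse hU hl hα).const_smul (1 / 2 : ℝ)).congr ?_
    rintro ⟨x, v⟩ hz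
    simp only [Function.uncurry_apply_pair, coordSpray, coordMetric_eq hU hl hz,
      coordForce_eq hU hl hz]
  spray := by
    rintro ⟨x, v⟩ hz Y
    have := congrArg (fun A : E →L[ℝ] ℝ => A Y)
      (hnd.verticalHessian_inverse hz (coordForce l x v))
    simp only [verticalHessian_apply] at this
    rw [Function.uncurry_apply_pair, coordSpray, map_prodMk_smul, coordMetric_eq hU hl hz,
      smul_apply, this, coordForce_eq hU hl hz]
    simp

theorem coordCurvature_eq_sprayCurvature (hU : IsOpen U)
    (hG : ContDiffOn ℝ ∞ (Function.uncurry (coordSpray l)) U) (hz : (x, v) ∈ U) (X : E) :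
    coordCurvature l x v X = sprayCurvature (Function.uncurry (coordSpray l)) (x, v) X := by
  have hN : ∀ X, coordConn l x v X =
      fderiv ℝ (Function.uncurry (coordSpray l)) (x, v) (0, X) := by
    intro X
    rw [coordConn, fderiv_partial_snd (differentiableAt_of_contDiffOn hG hU hz)]
    simp
  have hH : ∀ X Y, coordHorDerivConn l x v X Y =
      fderiv ℝ (fderiv ℝ (Function.uncurry (coordSpray l))) (x, v)
        (horLift (Function.uncurry (coordSpray l)) (x, v) X) (0, Y) := by
    intro X Y
    rw [coordHorDerivConn, horLift, map_prodMk_neg, sub_apply, sub_apply, ← hN,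
      ← fderiv_fst_snd hU hG hz, ← fderiv_snd_snd hU hG hz]
    rfl
  change coordHorDerivConn l x v X v - coordHorDerivConn l x v v X = _
  rw [hH, hH, sprayCurvature]

theorem coordCurvature_self (l : E → E → ℝ) (x v : E) : coordCurvature l x v v = 0 :=
  sub_self _

end CoordinateLink

/-! ### The conformal change in coordinates -/

section CoordinateConformal

variable {E : Type*} [NormedAddCommGroup E] [NormedSpace ℝ E] [FiniteDimensional ℝ E]
  {U : Set (E × E)} {l l' : E → E → ℝ} {x v : E}

theorem fderiv_coordCurvature (hU : IsOpen U) (hl : IsEulerOn U (Function.uncurry l))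
    (hnd : IsNondegOn U (Function.uncurry l)) (hz : (x, v) ∈ U) (X : E) :
    fderiv ℝ (Function.uncurry l) (x, v) (0, coordCurvature l x v X) = 0 := by
  have hG := isSpray_coordSpray hU hl.smooth hnd
  rw [coordCurvature_eq_sprayCurvature hU hG.smooth hz]
  exact hG.fderiv_sprayCurvature hU hl hz X

/-- Conformal Lagrangians with a smooth factor: at null vectors the curvatures differ by a
multiple of the identity, modulo the direction of the velocity. -/
theorem coordCurvature_conformal_of_smooth (hE : 1 < Module.finrank ℝ E) (hU : IsOpen U)
    (hl : IsEulerOn U (Function.uncurry l)) (hl' : IsEulerOn U (Function.uncurry l'))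
    (hnd : IsNondegOn U (Function.uncurry l)) (hnd' : IsNondegOn U (Function.uncurry l'))
    {c : E × E → ℝ} (hc : ContDiffOn ℝ ∞ c U) (hc0 : ∀ z ∈ U, c z ≠ 0)
    (h : ∀ z ∈ U, ∀ X Y, fderiv ℝ (fderiv ℝ (Function.uncurry l')) z (0, X) (0, Y) =
      c z * fderiv ℝ (fderiv ℝ (Function.uncurry l)) z (0, X) (0, Y))
    (hz : (x, v) ∈ U) (hlz : l x v = 0) :
    ∃ k : ℝ, ∀ X, fderiv ℝ (Function.uncurry l) (x, v) (0, X) = 0 → ∃ b : ℝ,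
      coordCurvature l' x v X = coordCurvature l x v X + k • X + b • v := by
  have hG := isSpray_coordSpray hU hl.smooth hnd
  have hG' := isSpray_coordSpray hU hl'.smooth hnd'
  have hcv : ∀ z ∈ U, ∀ X, fderiv ℝ c z (0, X) = 0 := fun z hz X =>
    fderiv_factor_vertical hE hU hl.smooth hl'.smooth hc hnd h hz X
  have hci : ContDiffOn ℝ ∞ (fun z => (c z)⁻¹) U := hc.inv hc0
  have hdc := contDiffOn_fderiv hc hU
  have ha : ContDiffOn ℝ ∞ (fun z => (c z)⁻¹ * fderiv ℝ c z (z.2, 0) * 2⁻¹) U :=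
    (hci.mul (hdc.clm_apply (contDiffOn_snd.prodMk contDiffOn_const))).mul contDiffOn_const
  let α : E × E → E →L[ℝ] ℝ := fun z => ((c z)⁻¹ * 2⁻¹) •
    (fderiv ℝ c z).comp (ContinuousLinearMap.inl ℝ E E)
  have hw := hnd.contDiffOn_inverse hU hl.smooth (α := α)
    ((hci.mul contDiffOn_const).smul (hdc.clm_comp contDiffOn_const))
  have hws : ∀ z ∈ U, ∀ Y, fderiv ℝ (fderiv ℝ (Function.uncurry l)) z
      (0, (verticalHessian (Function.uncurry l) z).inverse (α z)) (0, Y) =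
      (c z)⁻¹ * fderiv ℝ c z (Y, 0) / 2 := fun z hz Y => by
    rw [← verticalHessian_apply, hnd.verticalHessian_inverse hz]
    simp [α]
    ring
  have hav : ∀ z ∈ U, fderiv ℝ (fun z => (c z)⁻¹ * fderiv ℝ c z (z.2, 0) * 2⁻¹) z (0, z.2) =
      (c z)⁻¹ * fderiv ℝ c z (z.2, 0) * 2⁻¹ := by
    intro z hz
    have d := (((hasFDerivAt_of_contDiffOn hci hU hz).mul
      (hasFDerivAt_fderiv_apply hc hU hz (hasFDerivAt_base z))).mul_const (2⁻¹ : ℝ))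
    have d' : fderiv ℝ (fun z => (c z)⁻¹) z (0, z.2) = 0 := by
      have di := (hasDerivAt_inv (hc0 z hz)).comp_hasFDerivAt z
        (hasFDerivAt_of_contDiffOn hc hU hz)
      refine (congrArg (fun A => A (0, z.2)) di.fderiv).trans ?_
      simp [hcv z hz]
    have d'' : fderiv ℝ (fderiv ℝ c) z (0, z.2) (z.2, 0) = 0 := by
      rw [fderiv_fderiv_symm hc hU hz]
      have := congrArg (fun A => A (z.2, 0)) (hasFDerivAt_unique_of_eqOn hU hz
        (fun y hy => hcv y hy z.2)
        (hasFDerivAt_fderiv_apply hc hU hz (hasFDerivAt_const ((0, z.2) : E × E) z))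
        (hasFDerivAt_const (0 : ℝ) z))
      simpa using this
    refine (congrArg (fun A => A (0, z.2)) d.fderiv).trans ?_
    simp [d', d'']
    ring
  obtain ⟨k, hk⟩ := sprayCurvature_change hU hl hG (hG.isEulerOn hU hl hnd)
    (hG'.isEulerOn hU hl' hnd') ha hw hav
    (fun z hz => IsSpray.eq_add_of_conformal hU hl hl' hc hc0 hnd h hcv hG hG' (fun _ _ => (div_eq_mul_inv _ _).symm)
      hws hz) hz hlz
  refine ⟨k, fun X hX => ?_⟩
  rw [coordCurvature_eq_sprayCurvature hU hG.smooth hz,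
    coordCurvature_eq_sprayCurvature hU hG'.smooth hz]
  exact hk X hX

theorem coordCurvature_conformal (hE : 1 < Module.finrank ℝ E) (hU : IsOpen U)
    (hl : IsEulerOn U (Function.uncurry l)) (hl' : IsEulerOn U (Function.uncurry l'))
    (hnd : IsNondegOn U (Function.uncurry l)) (hnd' : IsNondegOn U (Function.uncurry l'))
    {c : E × E → ℝ} (hc0 : ∀ z ∈ U, c z ≠ 0)
    (h : ∀ z ∈ U, ∀ X Y, fderiv ℝ (fderiv ℝ (Function.uncurry l')) z (0, X) (0, Y) =
      c z * fderiv ℝ (fderiv ℝ (Function.uncurry l)) z (0, X) (0, Y))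
    (hz : (x, v) ∈ U) (hlz : l x v = 0) :
    ∃ k : ℝ, ∀ X, fderiv ℝ (Function.uncurry l) (x, v) (0, X) = 0 → ∃ b : ℝ,
      coordCurvature l' x v X = coordCurvature l x v X + k • X + b • v := by
  have : Nontrivial E := Module.nontrivial_of_finrank_pos (R := ℝ) (by omega)
  obtain ⟨X, hX⟩ := exists_ne (0 : E)
  -- On the open set `U'` where this Hessian coefficient is nonzero, `c` is the quotient of the two
  -- coefficients, hence smooth. Curvature is local, so `U'` suffices.
  obtain ⟨Y, hY⟩ : ∃ Y, fderiv ℝ (fderiv ℝ (Function.uncurry l)) (x, v) (0, X) (0, Y) ≠ 0 := by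
    by_contra! hY
    exact hX (hnd _ hz X hY)
  have hsm : ∀ {f : E × E → ℝ}, ContDiffOn ℝ ∞ f U →
      ContDiffOn ℝ ∞ (fun z => fderiv ℝ (fderiv ℝ f) z (0, X) (0, Y)) U := fun hf =>
    ((contDiffOn_fderiv (contDiffOn_fderiv hf hU) hU).clm_apply contDiffOn_const).clm_apply
      contDiffOn_const
  let U' : Set (E × E) := U ∩ (fun z =>
    fderiv ℝ (fderiv ℝ (Function.uncurry l)) z (0, X) (0, Y)) ⁻¹' {0}ᶜ
  have hU' : IsOpen U' :=
    (hsm hl.smooth).continuousOn.isOpen_inter_preimage hU isOpen_compl_singleton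
  have hsub : U' ⊆ U := Set.inter_subset_left
  have hc : ContDiffOn ℝ ∞ c U' := by
    refine (((hsm hl'.smooth).mono hsub).div ((hsm hl.smooth).mono hsub)
      fun z hz => hz.2).congr fun z hz => ?_
    have : fderiv ℝ (fderiv ℝ (Function.uncurry l)) z (0, X) (0, Y) ≠ 0 := hz.2
    rw [Pi.div_apply, h z hz.1, mul_div_assoc, div_self this, mul_one]
  exact coordCurvature_conformal_of_smooth hE hU' (hl.mono hsub) (hl'.mono hsub) (hnd.mono hsub)
    (hnd'.mono hsub) hc (fun z hz => hc0 z hz.1) (fun z hz => h z hz.1) ⟨hz, hY⟩ hlz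

end CoordinateConformal

/-! ### Linear algebra of the null quotient -/

section LinearAlgebra

theorem IsLorentzian.eq_zero {n : ℕ} {V : Type*} [AddCommGroup V] [Module ℝ V]
    (B : V →ₗ[ℝ] V →ₗ[ℝ] ℝ) (hB : IsLorentzian n (fun X Y => B X Y)) {X : V}
    (hX : ∀ Y, B X Y = 0) : X = 0 := by
  obtain ⟨b, hb⟩ := hB
  refine b.ext_elem fun j => ?_
  have h := hX (b j)
  rw [← b.sum_repr X, map_sum, LinearMap.sum_apply] at h
  simp only [map_smul, LinearMap.smul_apply, hb, smul_eq_mul, mul_ite, mul_zero,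
    Finset.sum_ite_eq', Finset.mem_univ, if_true] at h
  split_ifs at h <;> simpa using h

theorem finrank_ker_quotient_span {V : Type*} [AddCommGroup V] [Module ℝ V]
    [FiniteDimensional ℝ V] {α : V →ₗ[ℝ] ℝ} (hα : α ≠ 0) {v : V} (hv : v ≠ 0) (hαv : α v = 0) :
    Module.finrank ℝ (LinearMap.ker α ⧸ (Submodule.span ℝ {v}).comap (LinearMap.ker α).subtype)
      + 2 = Module.finrank ℝ V := by
  have h1 := Module.Dual.finrank_ker_add_one_of_ne_zero hα
  have h2 := Submodule.finrank_quotient_add_finrank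
    ((Submodule.span ℝ {v}).comap (LinearMap.ker α).subtype)
  have hle : Submodule.span ℝ {v} ≤ LinearMap.ker α := by
    rw [Submodule.span_singleton_le_iff_mem]; exact hαv
  rw [(Submodule.comapSubtypeEquivOfLe hle).finrank_eq, finrank_span_singleton hv] at h2
  omega

theorem sub_trace_smul_add_smul_id {V : Type*} [AddCommGroup V] [Module ℝ V]
    [FiniteDimensional ℝ V] {n : ℕ} (hn : Module.finrank ℝ V + 2 = n + 1)
    (A : Module.End ℝ V) (k : ℝ) :
    (A + k • LinearMap.id) - ((1 / ((n : ℝ) - 1)) * LinearMap.trace ℝ V (A + k • LinearMap.id)) •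
      (LinearMap.id : Module.End ℝ V) =
    A - ((1 / ((n : ℝ) - 1)) * LinearMap.trace ℝ V A) • (LinearMap.id : Module.End ℝ V) := by
  -- In dimension zero `n = 1` and `1 / (n - 1)` is the default `0`, but all endomorphisms agree.
  rcases Nat.eq_zero_or_pos (Module.finrank ℝ V) with h0 | h0
  · have : Subsingleton V := Module.finrank_zero_iff.1 h0
    exact LinearMap.ext fun x => Subsingleton.elim _ _
  · have hn' : (n : ℝ) - 1 = Module.finrank ℝ V := by
      have : ((Module.finrank ℝ V : ℕ) : ℝ) + 2 = n + 1 := by exact_mod_cast hn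
      linarith
    have h0' : (Module.finrank ℝ V : ℝ) ≠ 0 := by exact_mod_cast h0.ne'
    rw [hn', map_add, map_smul, LinearMap.trace_id, smul_eq_mul, mul_add,
      show 1 / (Module.finrank ℝ V : ℝ) * (k * Module.finrank ℝ V) = k by field_simp]
    module

theorem fderiv_fderiv_comp_equiv {E : Type*} [NormedAddCommGroup E] [NormedSpace ℝ E]
    {g : E → ℝ} (D : E ≃L[ℝ] E) {u : E} (hg : DifferentiableAt ℝ (fderiv ℝ g) (D u)) (X Y : E) :
    fderiv ℝ (fun w => fderiv ℝ (fun w => g (D w)) w) u X Y =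
      fderiv ℝ (fun w => fderiv ℝ g w) (D u) (D X) (D Y) := by
  have h : (fun w => fderiv ℝ (fun w => g (D w)) w) =
      fun w => (fderiv ℝ g (D w)).comp (D : E →L[ℝ] E) :=
    funext fun w => D.comp_right_fderiv (f := g)
  have h1 : HasFDerivAt (fun w => fderiv ℝ g (D w))
      ((fderiv ℝ (fderiv ℝ g) (D u)).comp (D : E →L[ℝ] E)) u :=
    HasFDerivAt.comp (g := fderiv ℝ g) u hg.hasFDerivAt D.hasFDerivAt
  have h2 := h1.clm_comp (hasFDerivAt_const (D : E →L[ℝ] E) u)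
  rw [h, h2.fderiv]
  simp

end LinearAlgebra

/-! ### Passing between the manifold and a chart -/

section Chart

variable {E : Type*} [NormedAddCommGroup E] [NormedSpace ℝ E]
  {M : Type*} [TopologicalSpace M] [ChartedSpace E M]
  {L L' : TangentBundle 𝓘(ℝ, E) M → ℝ} {φ : OpenPartialHomeomorph M E} {p : M} {n : ℕ}

theorem mdifferentiable_of_mem_maximalAtlas (hφ : φ ∈ IsManifold.maximalAtlas 𝓘(ℝ, E) ∞ M) :
    φ.MDifferentiable 𝓘(ℝ, E) 𝓘(ℝ, E) :=
  ⟨(contMDiffOn_of_mem_maximalAtlas hφ).mdifferentiableOn (by simp),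
    (contMDiffOn_symm_of_mem_maximalAtlas hφ).mdifferentiableOn (by simp)⟩

/-- The differential of a chart at a point of its domain. -/
def chartDeriv (hφ : φ ∈ IsManifold.maximalAtlas 𝓘(ℝ, E) ∞ M) (hp : p ∈ φ.source) : E ≃L[ℝ] E :=
  (mdifferentiable_of_mem_maximalAtlas hφ).mfderiv hp

theorem onFiber_eq_inChart (hφ : φ ∈ IsManifold.maximalAtlas 𝓘(ℝ, E) ∞ M) (hp : p ∈ φ.source)
    (u : E) : onFiber L p u = inChart L φ (φ p) (chartDeriv hφ hp u) := by
  have h1 : inChart L φ (φ p) (chartDeriv hφ hp u) = onFiber L (φ.symm (φ p))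
    ((chartDeriv hφ hp).symm (chartDeriv hφ hp u)) := rfl
  rw [h1, φ.left_inv hp, ContinuousLinearEquiv.symm_apply_apply]

/-- The part of the slit tangent bundle over a chart domain, in coordinates. -/
def slitDomain (φ : OpenPartialHomeomorph M E) : Set (E × E) := φ.target ×ˢ {0}ᶜ

omit [NormedSpace ℝ E] [ChartedSpace E M] in
theorem isOpen_slitDomain : IsOpen (slitDomain φ) :=
  φ.open_target.prod isOpen_compl_singleton

theorem mem_slitDomain (hφ : φ ∈ IsManifold.maximalAtlas 𝓘(ℝ, E) ∞ M) (hp : p ∈ φ.source)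
    {u : E} (hu : u ≠ 0) : (φ p, chartDeriv hφ hp u) ∈ slitDomain φ :=
  ⟨φ.map_source hp, (chartDeriv hφ hp).map_ne_zero_iff.2 hu⟩

/-- Lets hypotheses stated fibre by fibre on `M` be used at every point of the coordinate domain. -/
theorem exists_of_mem_slitDomain (hφ : φ ∈ IsManifold.maximalAtlas 𝓘(ℝ, E) ∞ M) {z : E × E}
    (hz : z ∈ slitDomain φ) : ∃ (p : M) (hp : p ∈ φ.source) (u : E), u ≠ 0 ∧
      z = (φ p, chartDeriv hφ hp u) := by
  obtain ⟨x, w⟩ := z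
  obtain ⟨hx, hw⟩ := hz
  refine ⟨φ.symm x, φ.map_target hx, (chartDeriv hφ (φ.map_target hx)).symm w,
    (chartDeriv hφ (φ.map_target hx)).symm.map_ne_zero_iff.2 hw, ?_⟩
  rw [φ.right_inv hx, ContinuousLinearEquiv.apply_symm_apply]

theorem curvature_apply (hφ : φ ∈ IsManifold.maximalAtlas 𝓘(ℝ, E) ∞ M) (hp : p ∈ φ.source)
    (v X : E) : (curvature L φ p v : Module.End ℝ E) X = (chartDeriv hφ hp).symm
      (coordCurvature (inChart L φ) (φ p) (chartDeriv hφ hp v) (chartDeriv hφ hp X)) := by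
  have h : (mfderiv 𝓘(ℝ, E) 𝓘(ℝ, E) φ p : E →L[ℝ] E).inverse =
      ((chartDeriv hφ hp).symm : E →L[ℝ] E) :=
    ContinuousLinearMap.inverse_equiv (chartDeriv hφ hp)
  change (mfderiv 𝓘(ℝ, E) 𝓘(ℝ, E) φ p : E →L[ℝ] E).inverse _ = _
  rw [h]
  rfl

theorem curvatureBar_conformal {v : TangentSpace 𝓘(ℝ, E) p}
    (hR : Descends L p v (curvature L φ p v)) (hR' : Descends L' p v (curvature L' φ p v))
    (h : nullHyperplane L p v = nullHyperplane L' p v) {k : ℝ}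
    (hk : ∀ X ∈ nullHyperplane L p v, ∃ b : ℝ,
      curvature L' φ p v X = curvature L φ p v X + k • X + b • v) :
    curvatureBar L' φ p v =
      (nullQuotientEquiv L L' p v h).conj (curvatureBar L φ p v) + k • LinearMap.id := by
  refine LinearMap.ext fun y => ?_
  obtain ⟨x, rfl⟩ := (nullQuotientEquiv L L' p v h).surjective y
  obtain ⟨⟨X, hX⟩, rfl⟩ := Submodule.Quotient.mk_surjective _ x
  rw [LinearMap.add_apply, LinearEquiv.conj_apply_apply, LinearEquiv.symm_apply_apply,
    curvatureBar, dif_pos hR', curvatureBar, dif_pos hR]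
  obtain ⟨b, hb⟩ := hk X hX
  refine (Submodule.Quotient.eq _).2 (Submodule.mem_span_singleton.2 ⟨b, ?_⟩)
  change b • v = curvature L' φ p v X - (curvature L φ p v X + k • X)
  rw [hb]
  abel

variable [IsManifold 𝓘(ℝ, E) ∞ M]

theorem contDiffOn_inChart (hL : IsLorentzFinsler n L)
    (hφ : φ ∈ IsManifold.maximalAtlas 𝓘(ℝ, E) ∞ M) :
    ContDiffOn ℝ ∞ (Function.uncurry (inChart L φ)) (slitDomain φ) := by
  have h1 : ContMDiffOn 𝓘(ℝ, E).tangent 𝓘(ℝ, E).tangent ∞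
      (tangentMapWithin 𝓘(ℝ, E) 𝓘(ℝ, E) φ.symm φ.target)
      ((fun w : TangentBundle 𝓘(ℝ, E) E => w.1) ⁻¹' φ.target) :=
    (contMDiffOn_symm_of_mem_maximalAtlas hφ).contMDiffOn_tangentMapWithin (by simp)
      φ.open_target.uniqueMDiffOn
  have h2 : ContMDiff 𝓘(ℝ, E × E) 𝓘(ℝ, E).tangent ∞
      (fun z : E × E => (⟨z.1, z.2⟩ : TangentBundle 𝓘(ℝ, E) E)) := by
    rw [modelWithCornersSelf_prod]
    exact contMDiff_tangentBundleModelSpaceHomeomorph_symm (I := 𝓘(ℝ, E))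
  have h3 := h1.comp (h2.contMDiffOn (s := slitDomain φ)) (fun z hz => hz.1)
  have h4 := hL.smooth.comp h3 (by
    rintro ⟨x, w⟩ ⟨hx, hw⟩
    change mfderivWithin 𝓘(ℝ, E) 𝓘(ℝ, E) φ.symm φ.target x w ≠ 0
    rw [mfderivWithin_of_isOpen φ.open_target hx]
    intro h0
    exact hw ((mdifferentiable_of_mem_maximalAtlas hφ).symm.mfderiv_injective hx
      (h0.trans (map_zero _).symm)))
  refine h4.contDiffOn.congr ?_
  rintro ⟨x, w⟩ ⟨hx, hw⟩
  change L ⟨φ.symm x, mfderiv 𝓘(ℝ, E) 𝓘(ℝ, E) φ.symm x w⟩ =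
    L ⟨φ.symm x, mfderivWithin 𝓘(ℝ, E) 𝓘(ℝ, E) φ.symm φ.target x w⟩
  rw [mfderivWithin_of_isOpen φ.open_target hx]

theorem isEulerOn_inChart (hL : IsLorentzFinsler n L)
    (hφ : φ ∈ IsManifold.maximalAtlas 𝓘(ℝ, E) ∞ M) :
    IsEulerOn (slitDomain φ) (Function.uncurry (inChart L φ)) where
  smooth := contDiffOn_inChart hL hφ
  euler := by
    intro z hz
    obtain ⟨p, hp, u, hu, rfl⟩ := exists_of_mem_slitDomain hφ hz
    set w := chartDeriv hφ hp u
    have hs : HasDerivAt (fun s : ℝ => (φ p, s • w)) (0, w) 1 :=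
      (hasDerivAt_const (1 : ℝ) (φ p)).prodMk (by
        simpa using (hasDerivAt_id (1 : ℝ)).smul_const w)
    have h1 : HasDerivAt (fun s : ℝ => inChart L φ (φ p) (s • w))
        (fderiv ℝ (Function.uncurry (inChart L φ)) (φ p, w) (0, w)) 1 := by
      refine HasFDerivAt.comp_hasDerivAt (l := Function.uncurry (inChart L φ)) 1 ?_ hs
      rw [one_smul]
      exact hasFDerivAt_of_contDiffOn (contDiffOn_inChart hL hφ) isOpen_slitDomain hz
    have h2 : HasDerivAt (fun s : ℝ => s ^ 2 * inChart L φ (φ p) w)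
        (2 * inChart L φ (φ p) w) 1 := by
      simpa using ((hasDerivAt_id (1 : ℝ)).pow 2).mul_const (inChart L φ (φ p) w)
    have h3 : (fun s : ℝ => inChart L φ (φ p) (s • w)) =ᶠ[nhds 1]
        fun s : ℝ => s ^ 2 * inChart L φ (φ p) w := by
      -- Homogeneity is only available for positive scalars, which suffices near `1`.
      filter_upwards [lt_mem_nhds (zero_lt_one' ℝ)] with s hs
      rw [← map_smul (chartDeriv hφ hp), ← onFiber_eq_inChart, ← onFiber_eq_inChart]
      exact hL.homogeneous p u hu s hs
    exact h1.unique (h2.congr_of_eventuallyEq h3)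

theorem metric_eq_coordMetric (hL : IsLorentzFinsler n L)
    (hφ : φ ∈ IsManifold.maximalAtlas 𝓘(ℝ, E) ∞ M) (hp : p ∈ φ.source) {u : E} (hu : u ≠ 0)
    (X Y : E) : fiberHessian L p u X Y =
      fderiv ℝ (fderiv ℝ (Function.uncurry (inChart L φ))) (φ p, chartDeriv hφ hp u)
        (0, chartDeriv hφ hp X) (0, chartDeriv hφ hp Y) := by
  have hz := mem_slitDomain hφ hp hu
  have hl := contDiffOn_inChart hL hφ
  have h : onFiber L p = fun w => inChart L φ (φ p) (chartDeriv hφ hp w) :=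
    funext (onFiber_eq_inChart hφ hp)
  have hg : DifferentiableAt ℝ (fderiv ℝ (inChart L φ (φ p))) (chartDeriv hφ hp u) :=
    ((hasFDerivAt_uncurry_fderiv_snd isOpen_slitDomain hl hz).comp _
      (hasFDerivAt_prodMk_right (φ p) (chartDeriv hφ hp u))).differentiableAt
  rw [← fderiv_snd_snd isOpen_slitDomain hl hz, ← fderiv_fderiv_comp_equiv _ hg, fiberHessian, h]

theorem isNondegOn_inChart (hL : IsLorentzFinsler n L)
    (hφ : φ ∈ IsManifold.maximalAtlas 𝓘(ℝ, E) ∞ M) :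
    IsNondegOn (slitDomain φ) (Function.uncurry (inChart L φ)) := by
  intro z hz X hX
  obtain ⟨p, hp, u, hu, rfl⟩ := exists_of_mem_slitDomain hφ hz
  have hB : IsLorentzian n (fun X Y => fiberHessian L p u X Y) := hL.lorentzian p u hu
  have := IsLorentzian.eq_zero ((fiberHessian L p u).toLinearMap₁₂) hB
    (X := (chartDeriv hφ hp).symm X) fun Y => by
      change fiberHessian L p u _ Y = 0
      rw [metric_eq_coordMetric hL hφ hp hu, ContinuousLinearEquiv.apply_symm_apply]
      exact hX _
  simpa using this

theorem exists_factor_inChart (hL : IsLorentzFinsler n L) (hL' : IsLorentzFinsler n L')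
    {Ω : TangentBundle 𝓘(ℝ, E) M → ℝ} (hΩ : ∀ w, w.2 ≠ 0 → 0 < Ω w)
    (hconf : ∀ (q : M) (w : TangentSpace 𝓘(ℝ, E) q), w ≠ 0 →
      metric L' q w = (Ω ⟨q, w⟩) ^ 2 • metric L q w)
    (hφ : φ ∈ IsManifold.maximalAtlas 𝓘(ℝ, E) ∞ M) :
    ∃ c : E × E → ℝ, ∀ z ∈ slitDomain φ, c z ≠ 0 ∧
      ∀ X Y, fderiv ℝ (fderiv ℝ (Function.uncurry (inChart L' φ))) z (0, X) (0, Y) =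
        c z * fderiv ℝ (fderiv ℝ (Function.uncurry (inChart L φ))) z (0, X) (0, Y) := by
  have : ∀ z, ∃ c : ℝ, z ∈ slitDomain φ → c ≠ 0 ∧
      ∀ X Y, fderiv ℝ (fderiv ℝ (Function.uncurry (inChart L' φ))) z (0, X) (0, Y) =
        c * fderiv ℝ (fderiv ℝ (Function.uncurry (inChart L φ))) z (0, X) (0, Y) := by
    intro z
    by_cases hz : z ∈ slitDomain φ
    · obtain ⟨p, hp, u, hu, rfl⟩ := exists_of_mem_slitDomain hφ hz
      refine ⟨Ω ⟨p, u⟩ ^ 2, fun _ => ⟨pow_ne_zero 2 (hΩ ⟨p, u⟩ hu).ne', fun X Y => ?_⟩⟩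
      have h : fiberHessian L' p u = Ω ⟨p, u⟩ ^ 2 • fiberHessian L p u := hconf p u hu
      have h' := congrArg (fun A : E →L[ℝ] E →L[ℝ] ℝ =>
        A ((chartDeriv hφ hp).symm X) ((chartDeriv hφ hp).symm Y)) h
      simpa [metric_eq_coordMetric hL hφ hp hu, metric_eq_coordMetric hL' hφ hp hu] using h'
    · exact ⟨0, fun h => absurd h hz⟩
  choose c hc using this
  exact ⟨c, hc⟩

/-- By Euler's relation `g_v(v, ·)` is the vertical differential of the Lagrangian. -/
theorem mem_nullHyperplane_iff (hL : IsLorentzFinsler n L)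
    (hφ : φ ∈ IsManifold.maximalAtlas 𝓘(ℝ, E) ∞ M) (hp : p ∈ φ.source) {v : E} (hv : v ≠ 0)
    (X : E) : X ∈ (nullHyperplane L p v : Submodule ℝ E) ↔
      fderiv ℝ (Function.uncurry (inChart L φ)) (φ p, chartDeriv hφ hp v)
        (0, chartDeriv hφ hp X) = 0 := by
  have hz := mem_slitDomain hφ hp hv
  have e := (isEulerOn_inChart hL hφ).snd isOpen_slitDomain hz (0, chartDeriv hφ hp X)
  rw [fderiv_fderiv_symm (contDiffOn_inChart hL hφ) isOpen_slitDomain hz] at e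
  change fiberHessian L p v v X = 0 ↔ _
  rw [metric_eq_coordMetric hL hφ hp hv, e, smul_eq_mul]
  constructor <;> intro h <;> linarith

theorem descends_curvature [FiniteDimensional ℝ E] (hL : IsLorentzFinsler n L)
    (hφ : φ ∈ IsManifold.maximalAtlas 𝓘(ℝ, E) ∞ M) (hp : p ∈ φ.source) {v : E} (hv : v ≠ 0) :
    Descends L p v (curvature L φ p v) := by
  constructor
  · refine (curvature_apply hφ hp v v).trans ?_
    rw [coordCurvature_self, map_zero]
    rfl
  · intro X
    refine (mem_nullHyperplane_iff hL hφ hp hv _).2 ?_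
    rw [curvature_apply hφ hp v X, ContinuousLinearEquiv.apply_symm_apply]
    exact fderiv_coordCurvature isOpen_slitDomain (isEulerOn_inChart hL hφ)
      (isNondegOn_inChart hL hφ) (mem_slitDomain hφ hp hv) _

theorem curvature_conformal [FiniteDimensional ℝ E] (hE : 1 < Module.finrank ℝ E)
    (hL : IsLorentzFinsler n L) (hL' : IsLorentzFinsler n L')
    {Ω : TangentBundle 𝓘(ℝ, E) M → ℝ} (hΩ : ∀ w, w.2 ≠ 0 → 0 < Ω w)
    (hconf : ∀ (q : M) (w : TangentSpace 𝓘(ℝ, E) q), w ≠ 0 →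
      metric L' q w = (Ω ⟨q, w⟩) ^ 2 • metric L q w)
    (hφ : φ ∈ IsManifold.maximalAtlas 𝓘(ℝ, E) ∞ M) (hp : p ∈ φ.source) {v : TangentSpace 𝓘(ℝ, E) p}
    (hv : v ≠ 0) (hlight : v ∈ nullHyperplane L p v) :
    ∃ k : ℝ, ∀ X ∈ nullHyperplane L p v, ∃ b : ℝ,
      curvature L' φ p v X = curvature L φ p v X + k • X + b • v := by
  have hz := mem_slitDomain hφ hp hv
  have hl := isEulerOn_inChart hL hφ
  obtain ⟨c, hc⟩ := exists_factor_inChart hL hL' hΩ hconf hφ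
  have hlz : inChart L φ (φ p) (chartDeriv hφ hp v) = 0 := by
    have e := hl.euler _ hz
    rw [(mem_nullHyperplane_iff hL hφ hp hv v).1 hlight] at e
    simpa using e.symm
  obtain ⟨k, hk⟩ := coordCurvature_conformal hE isOpen_slitDomain hl (isEulerOn_inChart hL' hφ)
    (isNondegOn_inChart hL hφ) (isNondegOn_inChart hL' hφ) (fun z hz => (hc z hz).1)
    (fun z hz => (hc z hz).2) hz hlz
  refine ⟨k, fun X hX => ?_⟩
  obtain ⟨b, hb⟩ := hk _ ((mem_nullHyperplane_iff hL hφ hp hv X).1 hX)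
  refine ⟨b, ?_⟩
  have e : ∀ (D : E ≃L[ℝ] E) {r r' R R' : E} (Y w : E), R = D.symm r → R' = D.symm r' →
      r' = r + k • D Y + b • D w → R' = R + k • Y + b • w := by
    rintro D r _ _ _ Y w rfl rfl rfl
    simp
  exact e (chartDeriv hφ hp) X v (curvature_apply hφ hp v X) (curvature_apply hφ hp v X) hb

end Chart

end FinslerSpacetime

theorem mainTheorem5 {E : Type*} [NormedAddCommGroup E] [NormedSpace ℝ E] [FiniteDimensional ℝ E]
    {M : Type*} [TopologicalSpace M] [ChartedSpace E M] [IsManifold 𝓘(ℝ, E) ∞ M]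
    (n : ℕ) (hn : Module.finrank ℝ E = n + 1)
    (L L' : TangentBundle 𝓘(ℝ, E) M → ℝ)
    (hL : FinslerSpacetime.IsLorentzFinsler n L) (hL' : FinslerSpacetime.IsLorentzFinsler n L')
    (Ω : TangentBundle 𝓘(ℝ, E) M → ℝ) (hΩ : ∀ w, w.2 ≠ 0 → 0 < Ω w)
    (hconf : ∀ (q : M) (w : TangentSpace 𝓘(ℝ, E) q), w ≠ 0 →
      FinslerSpacetime.metric L' q w = (Ω ⟨q, w⟩) ^ 2 • FinslerSpacetime.metric L q w)
    (φ : OpenPartialHomeomorph M E) (hφ : φ ∈ IsManifold.maximalAtlas 𝓘(ℝ, E) ∞ M)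
    (p : M) (hp : p ∈ φ.source)
    (v : TangentSpace 𝓘(ℝ, E) p) (hv : v ≠ 0) (hlight : FinslerSpacetime.metric L p v v v = 0) :
    FinslerSpacetime.Descends L p v (FinslerSpacetime.curvature L φ p v) ∧
    FinslerSpacetime.Descends L' p v (FinslerSpacetime.curvature L' φ p v) ∧
    ∃ h : FinslerSpacetime.nullHyperplane L p v = FinslerSpacetime.nullHyperplane L' p v,
      (FinslerSpacetime.nullQuotientEquiv L L' p v h).conj (FinslerSpacetime.weylBar n L φ p v) =
        FinslerSpacetime.weylBar n L' φ p v := by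
  have hR := FinslerSpacetime.descends_curvature hL hφ hp hv
  have hR' := FinslerSpacetime.descends_curvature hL' hφ hp hv
  have hT : FiniteDimensional ℝ (TangentSpace 𝓘(ℝ, E) p) := inferInstanceAs (FiniteDimensional ℝ E)
  have h : FinslerSpacetime.nullHyperplane L p v = FinslerSpacetime.nullHyperplane L' p v := by
    ext X
    change FinslerSpacetime.metric L p v v X = 0 ↔ FinslerSpacetime.metric L' p v v X = 0
    rw [hconf p v hv]
    change _ ↔ Ω ⟨p, v⟩ ^ 2 * FinslerSpacetime.metric L p v v X = 0
    rw [mul_eq_zero, or_iff_right (pow_ne_zero 2 (hΩ ⟨p, v⟩ hv).ne')]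
  have hfin : ∀ {K : TangentBundle 𝓘(ℝ, E) M → ℝ}, FinslerSpacetime.IsLorentzFinsler n K →
      FinslerSpacetime.metric K p v v v = 0 →
      Module.finrank ℝ (FinslerSpacetime.NullQuotient K p v) + 2 = n + 1 := by
    intro K hK hKv
    rw [← hn]
    refine FinslerSpacetime.finrank_ker_quotient_span (V := TangentSpace 𝓘(ℝ, E) p)
      (α := (FinslerSpacetime.metric K p v v).toLinearMap) (fun h0 => hv ?_) hv hKv
    exact FinslerSpacetime.IsLorentzian.eq_zero (FinslerSpacetime.metric K p v).toLinearMap₁₂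
      (hK.lorentzian p v hv) fun Y => LinearMap.congr_fun h0 Y
  have hq := hfin hL hlight
  have hq' := hfin hL' (show v ∈ FinslerSpacetime.nullHyperplane L' p v from h ▸ hlight)
  refine ⟨hR, hR', h, ?_⟩
  -- The bound `1 < finrank` comes from `hq`: the null quotient has dimension `n - 1`, so a
  -- lightlike vector forces `n ≥ 1`.
  obtain ⟨k, hk⟩ := FinslerSpacetime.curvature_conformal (by omega) hL hL' hΩ hconf hφ hp hv hlight
  rw [FinslerSpacetime.weylBar, FinslerSpacetime.weylBar,
    FinslerSpacetime.curvatureBar_conformal hR hR' h hk,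
    FinslerSpacetime.sub_trace_smul_add_smul_id hq', LinearMap.trace_conj', map_sub, map_smul]
  congr 2
  exact LinearEquiv.conj_id _

end
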